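/- Let $K$ be a field of characteristic $0$. A 3-Lie algebra is a $K$-vector space $\mathfrak g$ with a skew-symmetric trilinear bracket satisfying $[x_1,x_2,[x_3,x_4,x_5]]=[[x_1,x_2,x_3],x_4,x_5]+[x_3,[x_1,x_2,x_4],x_5]+[x_3,x_4,[x_1,x_2,x_5]]$. Let $(\mathfrak g,[\cdot,\cdot,\cdot]_{\mathfrak g})$ and $(\mathfrak h,[\cdot,\cdot,\cdot]_{\mathfrak h})$ be 3-Lie algebras and let $\rho:\wedge^2\mathfrak g\to\mathfrak{gl}(\mathfrak h)$ be an action, that is, a linear map with $\rho(x_1,x_2)\rho(x_3,x_4)=\rho([x_1,x_2,x_3]_{\mathfrak g},x_4)+\rho(x_3,[x_1,x_2,x_4]_{\mathfrak g})+\rho(x_3,x_4)\rho(x_1,x_2)$, $\rho(x_1,[x_2,x_3,x_4]_{\mathfrak g})=\rho(x_3,x_4)\rho(x_1,x_2)-\rho(x_2,x_4)\rho(x_1,x_3)+\rho(x_2,x_3)\rho(x_1,x_4)$, $[\rho(x,y)u,v,w]_{\mathfrak h}=0$ and $\rho(x,y)[u,v,w]_{\mathfrak h}=0$. Let $\lambda\in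 K$. A linear map $T:\mathfrak h\to\mathfrak g$ is a relative Rota-Baxter operator of weight $\lambda$ if for all $u,v,w\in\mathfrak h$ $$[Tu,Tv,Tw]_{\mathfrak g}=T\big(\rho(Tu,Tv)w+\rho(Tv,Tw)u+\rho(Tw,Tu)v+\lambda[u,v,w]_{\mathfrak h}\big).$$ For vector spaces $V,W$ put $C^n(V,W)=\mathrm{Hom}(\wedge^2V\otimes\cdots\otimes\wedge^2V\wedge V,W)$ with $n$ factors $\wedge^2V$: these are the maps $f(\mathfrak X_1,\dots,\mathfrak X_n,x)$, linear in each $\mathfrak X_i\in\wedge^2V$ and in $x\in V$, and (if $n\ge1$) skew-symmetric in $x_n,y_n,x$ when $\mathfrak X_n=x_n\wedge y_n$. Put $C^*(V,W)=\bigoplus_{n\ge0}C^n(V,W)$. On $C^*(V,V)$ let $[P,Q]=P\circ Q-(-1)^{pq}Q\circ P$ for $P\in C^p(V,V)$, $Q\in C^q(V,V)$, where, with $\mathfrak X_i=x_i\wedge y_i$, $$\begin{aligned}(P\circ Q)(\mathfrak X_1,\dots,\mathfrak X_{p+q},x)=&\sum_{k=1}^{p}(-1)^{(k-1)q}\sum_{\sigma\in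 S(k-1,q)}(-1)^\sigma P\big(\mathfrak X_{\sigma(1)},\dots,\mathfrak X_{\sigma(k-1)},\,A_\sigma x_{k+q}\wedge y_{k+q}+x_{k+q}\wedge A_\sigma y_{k+q},\,\mathfrak X_{k+q+1},\dots,\mathfrak X_{p+q},x\big)\\&+(-1)^{pq}\sum_{\sigma\in S(p,q)}(-1)^\sigma P\big(\mathfrak X_{\sigma(1)},\dots,\mathfrak X_{\sigma(p)},Q(\mathfrak X_{\sigma(p+1)},\dots,\mathfrak X_{\sigma(p+q)},x)\big),\end{aligned}$$ $A_\sigma=Q(\mathfrak X_{\sigma(k)},\dots,\mathfrak X_{\sigma(k+q-1)},\cdot)$, and $S(i,q)$ is the set of $(i,q)$-shuffles. Let $\Delta\in C^1(\mathfrak g\oplus\mathfrak h,\mathfrak g\oplus\mathfrak h)$ be $$\Delta(x+u,y+v,z+w)=[x,y,z]_{\mathfrak g}+\rho(x,y)w+\rho(y,z)u+\rho(z,x)v+\lambda[u,v,w]_{\mathfrak h},$$ regard $C^*(\mathfrak h,\mathfrak g)$ as a subspace of $C^*(\mathfrak g\oplus\mathfrak h,\mathfrak g\oplus\mathfrak h)$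 (extension by zero), let $\mathcal P$ be the projection onto it (restrict the arguments to $\mathfrak h$ and take the $\mathfrak g$-component of the value), and let $$l_k(a_1,\dots,a_k)=\mathcal P[\cdots[[\Delta,a_1],a_2],\cdots,a_k],\qquad a_i\in C^*(\mathfrak h,\mathfrak g),$$ be the higher derived brackets on $C^*(\mathfrak h,\mathfrak g)$. For a linear map $T:\mathfrak h\to\mathfrak g$, i.e. $T\in C^0(\mathfrak h,\mathfrak g)$, the twisted brackets are $$l_k^T(a_1,\dots,a_k)=\sum_{n\ge0}\frac1{n!}\,l_{n+k}(\underbrace{T,\dots,T}_{n},a_1,\dots,a_k).$$ A Maurer-Cartan element of $(C^*(\mathfrak h,\mathfrak g),\{l^T_k\}_{k\ge1})$ is an $\alpha\in C^0(\mathfrak h,\mathfrak g)$ with $\sum_{k\ge1}\frac1{k!}l^T_k(\alpha,\dots,\alpha)=0$ (a sum with finitely many nonzero terms). **Theorem.** Let $T:\mathfrak h\to\mathfrak g$ be a relative Rota-Baxter operator of weight $\lambda$ with respect to the action $\rho$, and let $T':\mathfrak h\to\mathfrak g$ be a linear map. Then $T+T'$ is a relative Rota-Baxter operator of weight $\lambda$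 if and only if $T'$ is a Maurer-Cartan element of the twisted $L_\infty$-algebra $(C^*(\mathfrak h,\mathfrak g),\{l_k^T\}_{k\ge1})$; and this holds if and only if $$l_1^T(T')+\tfrac12\,l_2^T(T',T')+\tfrac1{3!}\,l_3^T(T',T',T')=0.$$ -/

import Mathlib

open scoped DirectSum

noncomputable section

namespace ThreeLie

/-! ### Evaluation of alternating maps on explicit vectors -/

section Alternating

variable {K M N : Type*} [Field K] [AddCommGroup M] [Module K M] [AddCommGroup N] [Module K N]

theorem map_add3_left (f : M [⋀^Fin 3]→ₗ[K] N) (a b x y : M) :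
    f ![x + y, a, b] = f ![x, a, b] + f ![y, a, b] := by
  have h := f.map_update_add ![0, a, b] 0 x y
  convert h using 2 <;> (try congr 1) <;> (try (funext j; fin_cases j <;> rfl))

theorem map_smul3_left (f : M [⋀^Fin 3]→ₗ[K] N) (c : K) (a b x : M) :
    f ![c • x, a, b] = c • f ![x, a, b] := by
  have h := f.map_update_smul ![0, a, b] 0 c x
  convert h using 2 <;> (try congr 1) <;> (try (funext j; fin_cases j <;> rfl))

theorem map_add3_mid (f : M [⋀^Fin 3]→ₗ[K] N) (a b x y : M) :
    f ![a, x + y, b] = f ![a, x, b] + f ![a, y, b] := by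
  have h := f.map_update_add ![a, 0, b] 1 x y
  convert h using 2 <;> (try congr 1) <;> (try (funext j; fin_cases j <;> rfl))

theorem map_smul3_mid (f : M [⋀^Fin 3]→ₗ[K] N) (c : K) (a b x : M) :
    f ![a, c • x, b] = c • f ![a, x, b] := by
  have h := f.map_update_smul ![a, 0, b] 1 c x
  convert h using 2 <;> (try congr 1) <;> (try (funext j; fin_cases j <;> rfl))

theorem map_add3_right (f : M [⋀^Fin 3]→ₗ[K] N) (a b x y : M) :
    f ![a, b, x + y] = f ![a, b, x] + f ![a, b, y] := by
  have h := f.map_update_add ![a, b, 0] 2 x y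
  convert h using 2 <;> (try congr 1) <;> (try (funext j; fin_cases j <;> rfl))

theorem map_smul3_right (f : M [⋀^Fin 3]→ₗ[K] N) (c : K) (a b x : M) :
    f ![a, b, c • x] = c • f ![a, b, x] := by
  have h := f.map_update_smul ![a, b, 0] 2 c x
  convert h using 2 <;> (try congr 1) <;> (try (funext j; fin_cases j <;> rfl))

theorem map_add2_left (f : M [⋀^Fin 2]→ₗ[K] N) (a x y : M) :
    f ![x + y, a] = f ![x, a] + f ![y, a] := by
  have h := f.map_update_add ![0, a] 0 x y
  convert h using 2 <;> (try congr 1) <;> (try (funext j; fin_cases j <;> rfl))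

theorem map_smul2_left (f : M [⋀^Fin 2]→ₗ[K] N) (c : K) (a x : M) :
    f ![c • x, a] = c • f ![x, a] := by
  have h := f.map_update_smul ![0, a] 0 c x
  convert h using 2 <;> (try congr 1) <;> (try (funext j; fin_cases j <;> rfl))

theorem map_add2_right (f : M [⋀^Fin 2]→ₗ[K] N) (a x y : M) :
    f ![a, x + y] = f ![a, x] + f ![a, y] := by
  have h := f.map_update_add ![a, 0] 1 x y
  convert h using 2 <;> (try congr 1) <;> (try (funext j; fin_cases j <;> rfl))

theorem map_smul2_right (f : M [⋀^Fin 2]→ₗ[K] N) (c : K) (a x : M) :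
    f ![a, c • x] = c • f ![a, x] := by
  have h := f.map_update_smul ![a, 0] 1 c x
  convert h using 2 <;> (try congr 1) <;> (try (funext j; fin_cases j <;> rfl))

theorem map_self2 (f : M [⋀^Fin 2]→ₗ[K] N) (x : M) : f ![x, x] = 0 :=
  f.map_eq_zero_of_eq _ (i := 0) (j := 1) rfl (by decide)

theorem map_swap2 (f : M [⋀^Fin 2]→ₗ[K] N) (x y : M) : f ![x, y] = -f ![y, x] := by
  have h := map_self2 f (x + y)
  rw [map_add2_left, map_add2_right, map_add2_right, map_self2, map_self2, zero_add,
    add_zero] at h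
  exact eq_neg_of_add_eq_zero_left h

theorem map_eq_zero3 (f : M [⋀^Fin 3]→ₗ[K] N) (a b c : M) (h : a = b ∨ b = c ∨ a = c) :
    f ![a, b, c] = 0 := by
  rcases h with h | h | h
  · exact f.map_eq_zero_of_eq _ (i := 0) (j := 1) h (by decide)
  · exact f.map_eq_zero_of_eq _ (i := 1) (j := 2) h (by decide)
  · exact f.map_eq_zero_of_eq _ (i := 0) (j := 2) h (by decide)

end Alternating

/-! ### 3-Lie algebras, actions, relative Rota-Baxter operators -/

/-- A 3-Lie algebra structure on the vector space `g`: a skew-symmetric trilinear bracket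
satisfying the Fundamental Identity. -/
structure ThreeLieAlgebra (K g : Type*) [Field K] [AddCommGroup g] [Module K g] where
  bracket : g [⋀^Fin 3]→ₗ[K] g
  fundamental : ∀ x₁ x₂ x₃ x₄ x₅ : g,
    bracket ![x₁, x₂, bracket ![x₃, x₄, x₅]] =
      bracket ![bracket ![x₁, x₂, x₃], x₄, x₅] + bracket ![x₃, bracket ![x₁, x₂, x₄], x₅] +
        bracket ![x₃, x₄, bracket ![x₁, x₂, x₅]]

section Action

variable {K g h : Type*} [Field K] [AddCommGroup g] [Module K g] [AddCommGroup h] [Module K h]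

/-- The center `{x | [x, y, z] = 0 for all y, z}` of a 3-Lie algebra. -/
def ThreeLieAlgebra.center (π : ThreeLieAlgebra K g) : Set g :=
  {x | ∀ y z, π.bracket ![x, y, z] = 0}

/-- Representations of a 3-Lie algebra on a vector space. The linear map `ρ : ∧² g → gl(h)` is
given as an alternating bilinear map. -/
structure IsRepresentation (π : ThreeLieAlgebra K g) (ρ : g [⋀^Fin 2]→ₗ[K] Module.End K h) :
    Prop where
  comp_eq : ∀ x₁ x₂ x₃ x₄ : g,
    ρ ![x₁, x₂] * ρ ![x₃, x₄] =
      ρ ![π.bracket ![x₁, x₂, x₃], x₄] + ρ ![x₃, π.bracket ![x₁, x₂, x₄]] +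
        ρ ![x₃, x₄] * ρ ![x₁, x₂]
  bracket_eq : ∀ x₁ x₂ x₃ x₄ : g,
    ρ ![x₁, π.bracket ![x₂, x₃, x₄]] =
      ρ ![x₃, x₄] * ρ ![x₁, x₂] - ρ ![x₂, x₄] * ρ ![x₁, x₃] + ρ ![x₂, x₃] * ρ ![x₁, x₄]

/-- Actions of a 3-Lie algebra `(g, π)` on a 3-Lie algebra `(h, μ)`. -/
structure IsAction (π : ThreeLieAlgebra K g) (μ : ThreeLieAlgebra K h)
    (ρ : g [⋀^Fin 2]→ₗ[K] Module.End K h) : Prop extends IsRepresentation π ρ where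
  mem_center : ∀ (x y : g) (u : h), ρ ![x, y] u ∈ μ.center
  map_bracket : ∀ (x y : g) (u v w : h), ρ ![x, y] (μ.bracket ![u, v, w]) = 0

/-- `T : h → g` is a relative Rota-Baxter operator of weight `lam` with respect to `ρ`. -/
def IsRelativeRotaBaxter (π : ThreeLieAlgebra K g) (μ : ThreeLieAlgebra K h)
    (ρ : g [⋀^Fin 2]→ₗ[K] Module.End K h) (lam : K) (T : h →ₗ[K] g) : Prop :=
  ∀ u v w : h,
    π.bracket ![T u, T v, T w] =
      T (ρ ![T u, T v] w + ρ ![T v, T w] u + ρ ![T w, T u] v + lam • μ.bracket ![u, v, w])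

end Action

/-! ### Cochain spaces -/

section Cochain

variable (K V W : Type*) [Field K] [AddCommGroup V] [Module K V] [AddCommGroup W] [Module K W]

/-- The element `x ∧ y` of `∧² V`. -/
abbrev wedge {V : Type*} [AddCommGroup V] [Module K V] (x y : V) : ⋀[K]^2 V :=
  exteriorPower.ιMulti K 2 ![x, y]

/-- `C^n(V, W) = Hom(∧² V ⊗ ⋯ ⊗ ∧² V ∧ V, W)` with `n` factors `∧² V`: maps
`f (𝔛₁, …, 𝔛ₙ, x)`, linear in each `𝔛ᵢ ∈ ∧² V` and in `x ∈ V`, which are moreover skew-symmetric in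
the last three vectors `xₙ, yₙ, x`, where `𝔛ₙ = xₙ ∧ yₙ`. As `f` is already alternating in
`(xₙ, yₙ)`, this amounts to its vanishing when `yₙ = x`. For `n = 0` it is `Hom(V, W)`. -/
def Cochain (n : ℕ) :
    Submodule K (MultilinearMap K (fun _ : Fin n => ⋀[K]^2 V) (V →ₗ[K] W)) where
  carrier := {f | ∀ (X : Fin n → ⋀[K]^2 V) (i : Fin n), (i : ℕ) + 1 = n →
    ∀ x y : V, X i = wedge K x y → f X y = 0}
  add_mem' hf hg X i hi x y hX := by simp [hf X i hi x y hX, hg X i hi x y hX]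
  zero_mem' _ _ _ _ _ _ := rfl
  smul_mem' c f hf X i hi x y hX := by simp [hf X i hi x y hX]

/-- The graded vector space `C^*(V, W) = ⨁ₙ C^n(V, W)`. -/
abbrev Cochains : Type _ := ⨁ n, Cochain K V W n

instance (n : ℕ) : AddCommGroup (Cochain K V W n) := inferInstance

instance (n : ℕ) : Module K (Cochain K V W n) := inferInstance

instance : AddCommGroup (Cochains K V W) := inferInstance

instance : Module K (Cochains K V W) := inferInstance

variable {K V W}

/-- A linear map `V → W` as an element of `C^0(V, W)`, inside `C^*(V, W)`. -/
def ofHom (T : V →ₗ[K] W) : Cochains K V W :=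
  DirectSum.lof K ℕ (fun n => Cochain K V W n) 0
    ⟨MultilinearMap.constOfIsEmpty K _ T, fun _ i => i.elim0⟩

/-- A skew-symmetric trilinear map as an element of `C^1(V, W) = Hom(∧³ V, W)`:
it sends `(x ∧ y, z)` to `φ (z, x, y) = φ (x, y, z)`. -/
def ofAlternating (φ : V [⋀^Fin 3]→ₗ[K] W) : Cochain K V W 1 where
  val := LinearMap.compMultilinearMap
    (LinearMap.flip ((exteriorPower.alternatingMapLinearEquiv (R := K) (n := 2)
      (M := V) (N := W)).toLinearMap ∘ₗ φ.curryLeft))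
    (MultilinearMap.ofSubsingleton K (⋀[K]^2 V) (⋀[K]^2 V) (0 : Fin 1) LinearMap.id)
  property X i _ x y hX := by
    obtain rfl : i = 0 := Subsingleton.elim _ _
    simp only [LinearMap.compMultilinearMap_apply, MultilinearMap.ofSubsingleton_apply_apply,
      LinearMap.id_apply, hX, LinearMap.flip_apply, LinearMap.comp_apply,
      LinearEquiv.coe_coe, exteriorPower.alternatingMapLinearEquiv_apply_ιMulti,
      AlternatingMap.curryLeft_apply_apply]
    exact φ.map_eq_zero_of_eq _ (i := 0) (j := 2) rfl (by decide)

end Cochain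

/-! ### The graded Lie bracket on `C^*(V, V)` -/

section Bracket

variable {K V : Type*} [Field K] [AddCommGroup V] [Module K V]

theorem wedge_add_left (x y z : V) : wedge K (x + y) z = wedge K x z + wedge K y z :=
  map_add2_left _ _ _ _

theorem wedge_add_right (x y z : V) : wedge K z (x + y) = wedge K z x + wedge K z y :=
  map_add2_right _ _ _ _

theorem wedge_smul_left (c : K) (x z : V) : wedge K (c • x) z = c • wedge K x z :=
  map_smul2_left _ _ _ _

theorem wedge_smul_right (c : K) (x z : V) : wedge K z (c • x) = c • wedge K z x :=
  map_smul2_right _ _ _ _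

theorem wedge_self (x : V) : wedge K x x = 0 :=
  map_self2 _ x

theorem wedge_add_swap (x y : V) : wedge K x y + wedge K y x = 0 :=
  add_eq_zero_iff_eq_neg.mpr (map_swap2 _ x y)

/-- The derivation extension of `A : V → V` to `∧² V`: `x ∧ y ↦ A x ∧ y + x ∧ A y`,
depending linearly on `A`. -/
def der : Module.End K V →ₗ[K] Module.End K (⋀[K]^2 V) where
  toFun A := exteriorPower.alternatingMapLinearEquiv
    { toFun := fun v => wedge K (A (v 0)) (v 1) + wedge K (v 0) (A (v 1))
      map_update_add' := fun m i x y => by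
        fin_cases i <;> simp [wedge_add_left, wedge_add_right] <;> abel
      map_update_smul' := fun m i c x => by
        fin_cases i <;> simp [wedge_smul_left, wedge_smul_right]
      map_eq_zero_of_eq' := fun v i j hv hij => by
        have : v 0 = v 1 := by
          fin_cases i <;> fin_cases j <;> simp_all
        simp only [this]
        exact wedge_add_swap _ _ }
  map_add' A B := by
    apply exteriorPower.linearMap_ext
    ext v
    simp only [LinearMap.compAlternatingMap_apply, LinearMap.add_apply,
      exteriorPower.alternatingMapLinearEquiv_apply_ιMulti, AlternatingMap.coe_mk,
      MultilinearMap.coe_mk, wedge_add_left, wedge_add_right]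
    abel_nf
  map_smul' c A := by
    apply exteriorPower.linearMap_ext
    ext v
    simp only [LinearMap.compAlternatingMap_apply, LinearMap.smul_apply,
      exteriorPower.alternatingMapLinearEquiv_apply_ιMulti, AlternatingMap.coe_mk,
      MultilinearMap.coe_mk, wedge_smul_left, wedge_smul_right, RingHom.id_apply, smul_add]

theorem der_wedge (A : Module.End K V) (x y : V) :
    der A (wedge K x y) = wedge K (A x) y + wedge K x (A y) := by
  simp [der, exteriorPower.alternatingMapLinearEquiv_apply_ιMulti]

/-- A function that is linear in each variable, as a multilinear map. -/
def mkMultilinear {n : ℕ} {M N : Type*} [AddCommGroup M] [Module K M] [AddCommGroup N]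
    [Module K N] (f : (Fin n → M) → N)
    (hf : ∀ Y a, ∃ g : M →ₗ[K] N, ∀ z, f (Function.update Y a z) = g z) :
    MultilinearMap K (fun _ : Fin n => M) N where
  toFun := f
  map_update_add' {inst} Y a x y := by
    obtain rfl : inst = instDecidableEqFin n := Subsingleton.elim _ _
    obtain ⟨g, hg⟩ := hf Y a
    simp [hg]
  map_update_smul' {inst} Y a c x := by
    obtain rfl : inst = instDecidableEqFin n := Subsingleton.elim _ _
    obtain ⟨g, hg⟩ := hf Y a
    simp [hg]

variable {p q : ℕ}

/-- For `i` counted from `0`, the `p` arguments `𝔜₁, …, 𝔜ᵢ, Q(𝔜ᵢ₊₁, …, 𝔜ᵢ₊q, -) · 𝔜ᵢ₊q₊₁, 𝔜ᵢ₊q₊₂, …, 𝔜ₚ₊q` of `P`, where an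
endomorphism `A` acts on `∧² V` by `A · (x ∧ y) = A x ∧ y + x ∧ A y`. -/
def insertArgs (Q : MultilinearMap K (fun _ : Fin q => ⋀[K]^2 V) (Module.End K V)) (i : Fin p)
    (Y : Fin (p + q) → ⋀[K]^2 V) (j : Fin p) : ⋀[K]^2 V :=
  if j < i then Y ⟨j, by omega⟩
  else if j = i then der (Q fun m => Y ⟨i + m, by omega⟩) (Y ⟨i + q, by omega⟩)
  else Y ⟨j + q, by omega⟩

/-- `P(𝔜₁, …, 𝔜ᵢ, Q(𝔜ᵢ₊₁, …, 𝔜ᵢ₊q, -) · 𝔜ᵢ₊q₊₁, 𝔜ᵢ₊q₊₂, …, 𝔜ₚ₊q, x)`. -/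
def insertTerm (P : MultilinearMap K (fun _ : Fin p => ⋀[K]^2 V) (Module.End K V))
    (Q : MultilinearMap K (fun _ : Fin q => ⋀[K]^2 V) (Module.End K V)) (i : Fin p) :
    MultilinearMap K (fun _ : Fin (p + q) => ⋀[K]^2 V) (Module.End K V) :=
  mkMultilinear (fun Y => P (insertArgs Q i Y)) <| by
    intro Y a
    by_cases h1 : (a : ℕ) < i
    · refine ⟨P.toLinearMap (insertArgs Q i Y) ⟨a, by omega⟩, fun z => ?_⟩
      simp only [MultilinearMap.toLinearMap_apply, LinearMap.comp_apply,
        LinearMap.applyₗ_apply_apply]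
      congr 1
      funext j
      rcases lt_trichotomy j i with hj | hj | hj
      all_goals
        simp only [insertArgs, Function.update_apply, Fin.ext_iff, Fin.lt_def] at *
        grind
    by_cases h2 : (a : ℕ) < i + q
    · refine ⟨P.toLinearMap (insertArgs Q i Y) i ∘ₗ LinearMap.applyₗ (Y ⟨i + q, by omega⟩) ∘ₗ der ∘ₗ
        Q.toLinearMap (fun m => Y ⟨i + m, by omega⟩) ⟨a - i, by omega⟩, fun z => ?_⟩
      have hQ : (fun m : Fin q => Function.update Y a z ⟨i + m, by omega⟩) =
          Function.update (fun m : Fin q => Y ⟨i + m, by omega⟩) ⟨a - i, by omega⟩ z := by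
        funext m
        simp only [Function.update_apply, Fin.ext_iff]
        grind
      simp only [MultilinearMap.toLinearMap_apply, LinearMap.comp_apply,
        LinearMap.applyₗ_apply_apply]
      congr 1
      funext j
      rcases lt_trichotomy j i with hj | hj | hj
      all_goals
        simp only [insertArgs, hQ]
        clear hQ
        simp only [insertArgs, Function.update_apply, Fin.ext_iff, Fin.lt_def] at *
        grind
    by_cases h3 : (a : ℕ) = i + q
    · refine ⟨P.toLinearMap (insertArgs Q i Y) i ∘ₗ der (Q fun m => Y ⟨i + m, by omega⟩),
        fun z => ?_⟩
      simp only [MultilinearMap.toLinearMap_apply, LinearMap.comp_apply,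
        LinearMap.applyₗ_apply_apply]
      congr 1
      funext j
      rcases lt_trichotomy j i with hj | hj | hj
      all_goals
        simp only [insertArgs, Function.update_apply, Fin.ext_iff, Fin.lt_def] at *
        grind
    · refine ⟨P.toLinearMap (insertArgs Q i Y) ⟨a - q, by omega⟩, fun z => ?_⟩
      simp only [MultilinearMap.toLinearMap_apply, LinearMap.comp_apply,
        LinearMap.applyₗ_apply_apply]
      congr 1
      funext j
      rcases lt_trichotomy j i with hj | hj | hj
      all_goals
        simp only [insertArgs, Function.update_apply, Fin.ext_iff, Fin.lt_def] at *
        grind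

/-- `P(𝔜₁, …, 𝔜ₚ, Q(𝔜ₚ₊₁, …, 𝔜ₚ₊q, x))`. -/
def lastTerm (P : MultilinearMap K (fun _ : Fin p => ⋀[K]^2 V) (Module.End K V))
    (Q : MultilinearMap K (fun _ : Fin q => ⋀[K]^2 V) (Module.End K V)) :
    MultilinearMap K (fun _ : Fin (p + q) => ⋀[K]^2 V) (Module.End K V) :=
  mkMultilinear (fun Y => P (fun j => Y (Fin.castAdd q j)) * Q (fun m => Y (Fin.natAdd p m))) <| by
    intro Y a
    by_cases h1 : (a : ℕ) < p
    · refine ⟨LinearMap.mulRight K (Q fun m => Y (Fin.natAdd p m)) ∘ₗ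
        P.toLinearMap (fun j => Y (Fin.castAdd q j)) ⟨a, h1⟩, fun z => ?_⟩
      have hP : (fun j : Fin p => Function.update Y a z (Fin.castAdd q j)) =
          Function.update (fun j : Fin p => Y (Fin.castAdd q j)) ⟨a, h1⟩ z := by
        funext m
        simp only [Function.update_apply, Fin.ext_iff, Fin.val_castAdd]
      have hQ : (fun m : Fin q => Function.update Y a z (Fin.natAdd p m)) =
          fun m : Fin q => Y (Fin.natAdd p m) := by
        funext m
        simp only [Function.update_apply, Fin.ext_iff, Fin.val_natAdd]
        grind
      simp [hP, hQ]
    · refine ⟨LinearMap.mulLeft K (P fun j => Y (Fin.castAdd q j)) ∘ₗ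
        Q.toLinearMap (fun m => Y (Fin.natAdd p m)) ⟨a - p, by omega⟩, fun z => ?_⟩
      have hP : (fun j : Fin p => Function.update Y a z (Fin.castAdd q j)) =
          fun j : Fin p => Y (Fin.castAdd q j) := by
        funext m
        simp only [Function.update_apply, Fin.ext_iff, Fin.val_castAdd]
        grind
      have hQ : (fun m : Fin q => Function.update Y a z (Fin.natAdd p m)) =
          Function.update (fun m : Fin q => Y (Fin.natAdd p m)) ⟨a - p, by omega⟩ z := by
        funext m
        simp only [Function.update_apply, Fin.ext_iff, Fin.val_natAdd]
        grind
      simp [hP, hQ]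

/-- The `(i, q)`-shuffles of the first `i + q` of `N` indices: permutations `σ` with
`σ(1) < ⋯ < σ(i)` and `σ(i+1) < ⋯ < σ(i+q)` that fix all further indices. -/
def shuffles (N i q : ℕ) : Finset (Equiv.Perm (Fin N)) :=
  {σ | (∀ a b : Fin N, a < b → (b : ℕ) < i → σ a < σ b) ∧
    (∀ a b : Fin N, i ≤ (a : ℕ) → a < b → (b : ℕ) < i + q → σ a < σ b) ∧
    ∀ a : Fin N, i + q ≤ (a : ℕ) → σ a = a}

/-- The product `P ∘ Q`, before the skew-symmetry of the result is taken into account.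
The index `i` is `k - 1` in the usual notation. -/
def compAux (P : MultilinearMap K (fun _ : Fin p => ⋀[K]^2 V) (Module.End K V))
    (Q : MultilinearMap K (fun _ : Fin q => ⋀[K]^2 V) (Module.End K V)) :
    MultilinearMap K (fun _ : Fin (p + q) => ⋀[K]^2 V) (Module.End K V) :=
  (∑ i : Fin p, (-1 : ℤ) ^ ((i : ℕ) * q) • ∑ σ ∈ shuffles (p + q) i q,
      (Equiv.Perm.sign σ : ℤ) • (insertTerm P Q i).domDomCongr σ) +
    (-1 : ℤ) ^ (p * q) • ∑ σ ∈ shuffles (p + q) p q,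
      (Equiv.Perm.sign σ : ℤ) • (lastTerm P Q).domDomCongr σ

theorem compAux_apply (P : MultilinearMap K (fun _ : Fin p => ⋀[K]^2 V) (Module.End K V))
    (Q : MultilinearMap K (fun _ : Fin q => ⋀[K]^2 V) (Module.End K V))
    (X : Fin (p + q) → ⋀[K]^2 V) :
    compAux P Q X =
      (∑ i : Fin p, (-1 : ℤ) ^ ((i : ℕ) * q) • ∑ σ ∈ shuffles (p + q) i q,
        (Equiv.Perm.sign σ : ℤ) • P (insertArgs Q i fun j => X (σ j))) +
      (-1 : ℤ) ^ (p * q) • ∑ σ ∈ shuffles (p + q) p q, (Equiv.Perm.sign σ : ℤ) •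
        (P (fun j => X (σ (Fin.castAdd q j))) * Q fun m => X (σ (Fin.natAdd p m))) := by
  simp only [compAux, add_apply, sum_apply,
    smul_apply, MultilinearMap.domDomCongr_apply]
  rfl

theorem insertArgs_eq_update (Q : MultilinearMap K (fun _ : Fin q => ⋀[K]^2 V) (Module.End K V))
    (i : Fin p) (Y : Fin (p + q) → ⋀[K]^2 V) :
    insertArgs Q i Y = Function.update (insertArgs 0 i Y) i
      (der (Q fun m => Y ⟨i + m, by omega⟩) (Y ⟨i + q, by omega⟩)) := by
  funext j
  rcases lt_trichotomy j i with hj | hj | hj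
  · simp [insertArgs, hj, hj.ne]
  · subst hj; simp [insertArgs]
  · simp [insertArgs, hj.not_gt, hj.ne']

theorem cochain_polarize {n : ℕ} (f : Cochain K V V n) (Y : Fin n → ⋀[K]^2 V) (i : Fin n)
    (hi : (i : ℕ) + 1 = n) (x y z : V) :
    f.1 (Function.update Y i (wedge K x y)) z + f.1 (Function.update Y i (wedge K x z)) y = 0 := by
  have key : ∀ w, f.1 (Function.update Y i (wedge K x w)) w = 0 :=
    fun w => f.2 _ i hi x w (Function.update_self ..)
  have h := key (y + z)
  rw [wedge_add_right, MultilinearMap.map_update_add, LinearMap.add_apply, map_add, map_add,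
    key, key, zero_add, add_zero] at h
  exact h

/-- The shuffles of `p' + q` indices correspond to the shuffles in which the last index is moved
to position `p'`. -/
theorem mem_shuffles_iff {p' q : ℕ} {l : Fin (p' + 1 + q)} (hlv : (l : ℕ) = p' + q)
    {c : Equiv.Perm (Fin (p' + 1 + q))}
    (h1 : ∀ a : Fin (p' + 1 + q), (a : ℕ) < p' → c⁻¹ a = a)
    (h2 : c⁻¹ ⟨p', by omega⟩ = l)
    (h3 : ∀ a : Fin (p' + 1 + q), p' < (a : ℕ) → c⁻¹ a = ⟨a - 1, by omega⟩)
    (τ : Equiv.Perm (Fin (p' + 1 + q))) :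
    τ ∈ shuffles (p' + 1 + q) p' q ↔ τ * c⁻¹ ∈ shuffles (p' + 1 + q) (p' + 1) q ∧
      (τ * c⁻¹) ⟨p', by omega⟩ = l := by
  simp only [shuffles, Finset.mem_filter, Finset.mem_univ, true_and, Equiv.Perm.mul_apply, h2]
  constructor
  · rintro ⟨ha, hb, hc⟩
    have hl := hc l hlv.ge
    refine ⟨⟨fun a b hab hbp => ?_, fun a b hpa hab hbq => ?_, fun a ha' => by omega⟩, hl⟩
    · rw [h1 a (by omega)]
      by_cases hb' : (b : ℕ) < p'
      · rw [h1 b hb']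
        exact ha a b hab hb'
      · have hbe : b = ⟨p', by omega⟩ := Fin.ext (by simp; omega)
        rw [hbe, h2, hl]
        have hne : τ a ≠ l := by
          intro h
          have := τ.injective (h.trans hl.symm)
          simp only [Fin.ext_iff, Fin.lt_def] at this hab
          omega
        simp only [ne_eq, Fin.ext_iff, Fin.lt_def] at hne ⊢
        omega
    · simp only [Fin.lt_def] at hab
      rw [h3 a (by omega), h3 b (by omega)]
      exact hb _ _ (by simp; omega) (by rw [Fin.lt_def]; simp; omega) (by simp; omega)
  · rintro ⟨⟨ha, hb, -⟩, hl⟩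
    refine ⟨fun a b hab hbp => ?_, fun a b hpa hab hbq => ?_, fun a ha' => ?_⟩
    · have := ha a b hab (by omega)
      rw [Fin.lt_def] at hab
      rwa [h1 a (by omega), h1 b (by omega)] at this
    · rw [Fin.lt_def] at hab
      have := hb ⟨a + 1, by omega⟩ ⟨b + 1, by omega⟩ (by simp; omega) (by rw [Fin.lt_def]; simp; omega)
        (by simp; omega)
      rwa [h3 _ (by simp; omega), h3 _ (by simp; omega)] at this
    · have hae : a = l := Fin.ext (by omega)
      rw [hae, hl]

theorem insertArgs_of_lt (Q : MultilinearMap K (fun _ : Fin q => ⋀[K]^2 V) (Module.End K V))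
    {i j : Fin p} (h : i < j) (Y : Fin (p + q) → ⋀[K]^2 V) :
    insertArgs Q i Y j = Y ⟨j + q, by omega⟩ := by
  simp [insertArgs, h.not_gt, h.ne']

theorem compAux_mem (P : Cochain K V V p) (Q : Cochain K V V q) :
    compAux P.1 Q.1 ∈ Cochain K V V (p + q) := by
  intro X l hl x y hX
  rw [compAux_apply]
  -- a shuffle preserving the last position contributes zero to the last sum
  have hlast : ∀ σ : Equiv.Perm (Fin (p + q)), 0 < q → σ l = l →
      (P.1 (fun j => X (σ (Fin.castAdd q j))) * Q.1 fun m => X (σ (Fin.natAdd p m))) y = 0 := by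
    intro σ hq hσ
    rw [Module.End.mul_apply, Q.2 _ ⟨q - 1, by omega⟩ (by simp; omega) x y, map_zero]
    have : Fin.natAdd p (⟨q - 1, by omega⟩ : Fin q) = l := Fin.ext (by simp; omega)
    rw [this, hσ, hX]
  rcases p with _ | p'
  · simp only [Finset.univ_eq_empty, Finset.sum_empty, zero_add, LinearMap.smul_apply,
      LinearMap.sum_apply]
    rw [Finset.sum_eq_zero, smul_zero]
    intro σ hσ
    rw [hlast σ (by omega), smul_zero]
    simp only [shuffles, Finset.mem_filter] at hσ
    by_contra hne
    obtain ⟨a, ha⟩ := σ.surjective l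
    have hal : a ≠ l := by rintro rfl; exact hne ha
    have := hσ.2.2.1 a l (by simp) (by rw [Fin.lt_def]; rw [ne_eq, Fin.ext_iff] at hal; omega)
      (by omega)
    rw [ha, Fin.lt_def] at this
    omega
  · have hldef : (l : ℕ) = p' + q := by omega
    set c : Equiv.Perm (Fin (p' + 1 + q)) := Fin.cycleIcc ⟨p', by omega⟩ l with hc
    have hpl : (⟨p', by omega⟩ : Fin (p' + 1 + q)) ≤ l := by simp [Fin.le_def, hldef]
    have h1 : ∀ a : Fin (p' + 1 + q), (a : ℕ) < p' → c⁻¹ a = a := fun a ha => by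
      rw [Equiv.Perm.inv_eq_iff_eq, hc, Fin.cycleIcc_of_lt (by simpa [Fin.lt_def] using ha)]
    have h2 : c⁻¹ ⟨p', by omega⟩ = l := by
      rw [Equiv.Perm.inv_eq_iff_eq, hc, Fin.cycleIcc_of_last hpl]
    have h3 : ∀ a : Fin (p' + 1 + q), p' < (a : ℕ) → c⁻¹ a = ⟨a - 1, by omega⟩ := fun a ha => by
      rw [Equiv.Perm.inv_eq_iff_eq, hc, Fin.cycleIcc_of_ge_of_lt]
      · apply Fin.ext
        rw [Fin.val_add_one_of_lt' (by simp; omega)]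
        simp; omega
      · simp [Fin.le_def]; omega
      · simp [Fin.lt_def, hldef]; omega
    have hsign : (Equiv.Perm.sign c⁻¹ : ℤ) = (-1) ^ q := by
      rw [Equiv.Perm.sign_inv, hc, Fin.sign_cycleIcc_of_le hpl]
      simp [hldef]
    -- the last sum reduces to the shuffles moving the last index to position `p'`
    have hS2 : (∑ σ ∈ shuffles (p' + 1 + q) (p' + 1) q, (Equiv.Perm.sign σ : ℤ) •
        (P.1 (fun j => X (σ (Fin.castAdd q j))) * Q.1 fun m => X (σ (Fin.natAdd (p' + 1) m)))) y =
        ∑ τ ∈ shuffles (p' + 1 + q) p' q, (Equiv.Perm.sign (τ * c⁻¹) : ℤ) •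
          (P.1 (fun j => X ((τ * c⁻¹) (Fin.castAdd q j))) *
            Q.1 fun m => X ((τ * c⁻¹) (Fin.natAdd (p' + 1) m))) y := by
      rw [LinearMap.sum_apply]
      symm
      apply Finset.sum_of_injOn (fun τ => τ * c⁻¹) (mul_left_injective _).injOn
      · intro τ hτ
        exact ((mem_shuffles_iff hldef h1 h2 h3 τ).1 hτ).1
      · intro σ hσ hn
        rw [LinearMap.smul_apply]
        have hσp : σ ⟨p', by omega⟩ ≠ l := by
          intro h
          refine hn ⟨σ * c, (mem_shuffles_iff hldef h1 h2 h3 _).2 ?_, by simp⟩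
          rw [mul_inv_cancel_right]
          exact ⟨hσ, h⟩
        simp only [shuffles, Finset.mem_filter] at hσ
        obtain ⟨a, ha⟩ := σ.surjective l
        have hap : p' < (a : ℕ) := by
          by_contra hap
          have hne : a ≠ ⟨p', by omega⟩ := fun h => hσp (h ▸ ha)
          have := hσ.2.1 a ⟨p', by omega⟩
            (by rw [ne_eq, Fin.ext_iff] at hne; simp [Fin.lt_def] at hne ⊢; omega) (by simp)
          rw [ha, Fin.lt_def] at this
          omega
        rw [hlast σ (by omega), smul_zero]
        by_contra hne
        have hal : a ≠ l := by rintro rfl; exact hne ha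
        have := hσ.2.2.1 a l (by omega)
          (by rw [ne_eq, Fin.ext_iff] at hal; rw [Fin.lt_def]; omega)
          (by omega)
        rw [ha, Fin.lt_def] at this
        omega
      · intro τ _
        rfl
    rw [LinearMap.add_apply, LinearMap.smul_apply _ (∑ σ ∈ _, _), hS2, Fin.sum_univ_castSucc,
      LinearMap.add_apply, LinearMap.sum_apply, Finset.sum_eq_zero, zero_add]
    · -- the two remaining families cancel
      rw [LinearMap.smul_apply, LinearMap.sum_apply, Finset.smul_sum, Finset.smul_sum,
        Fin.val_last, ← Finset.sum_add_distrib]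
      refine Finset.sum_eq_zero fun τ hτ => ?_
      simp only [shuffles, Finset.mem_filter] at hτ
      have hτl : τ l = l := hτ.2.2.2 l hldef.ge
      set A := Q.1 fun m => X (τ ⟨p' + m, by omega⟩) with hA
      set Z := insertArgs (0 : MultilinearMap K (fun _ : Fin q => ⋀[K]^2 V) (Module.End K V))
        (Fin.last p') fun j => X (τ j) with hZ
      have e1 : insertArgs Q.1 (Fin.last p') (fun j => X (τ j)) =
          Function.update Z (Fin.last p') (wedge K (A x) y + wedge K x (A y)) := by
        rw [insertArgs_eq_update]
        congr 1
        have : (⟨(Fin.last p' : ℕ) + q, by simp⟩ : Fin (p' + 1 + q)) = l :=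
          Fin.ext (by simp [hldef])
        rw [← der_wedge, this, hτl, hX]
        rfl
      have e2 : (fun j => X ((τ * c⁻¹) (Fin.castAdd q j))) =
          Function.update Z (Fin.last p') (wedge K x y) := by
        funext j
        by_cases hj : j = Fin.last p'
        · subst hj
          rw [Function.update_self, Equiv.Perm.mul_apply]
          have : Fin.castAdd q (Fin.last p') = ⟨p', by omega⟩ := rfl
          rw [this, h2, hτl, hX]
        · have hjl : (j : ℕ) < p' := Fin.val_lt_last hj
          rw [Function.update_of_ne hj, Equiv.Perm.mul_apply, h1 _ (by simpa using hjl), hZ,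
            insertArgs, if_pos (by simpa [Fin.lt_def] using hjl)]
          rfl
      have e3 : (Q.1 fun m => X ((τ * c⁻¹) (Fin.natAdd (p' + 1) m))) = A := by
        rw [hA]
        congr 1
        funext m
        rw [Equiv.Perm.mul_apply, h3 _ (by simp; omega)]
        congr 2
        apply Fin.ext
        simp
        try omega
      have hp : P.1 (Function.update Z (Fin.last p') (wedge K (A x) y)) y = 0 :=
        P.2 _ (Fin.last p') rfl (A x) y (Function.update_self ..)
      have hp' := cochain_polarize P Z (Fin.last p') rfl x y (A y)
      rw [e1, e2, e3, MultilinearMap.map_update_add, Equiv.Perm.sign_mul, Units.val_mul, hsign,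
        LinearMap.smul_apply, LinearMap.add_apply, hp, zero_add, Module.End.mul_apply,
        eq_neg_of_add_eq_zero_left hp', smul_smul, smul_smul]
      have hone : ((-1 : ℤ) ^ q) * (-1) ^ q = 1 := by rw [← mul_pow]; simp
      have hcoef : (-1 : ℤ) ^ ((p' + 1) * q) * ((Equiv.Perm.sign τ : ℤ) * (-1) ^ q) =
          (-1) ^ (p' * q) * (Equiv.Perm.sign τ : ℤ) := by
        rw [add_mul, one_mul, pow_add]
        linear_combination (-1 : ℤ) ^ (p' * q) * (Equiv.Perm.sign τ : ℤ) * hone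
      rw [hcoef, smul_neg, add_neg_cancel]
    · intro i _
      rw [LinearMap.smul_apply, LinearMap.sum_apply, Finset.sum_eq_zero, smul_zero]
      intro σ hσ
      simp only [shuffles, Finset.mem_filter] at hσ
      have hi : (i.castSucc : Fin (p' + 1)) < Fin.last p' := Fin.castSucc_lt_last i
      rw [LinearMap.smul_apply, P.2 _ (Fin.last p') rfl x y, smul_zero]
      rw [insertArgs_of_lt _ hi, ← hX]
      have : (⟨(Fin.last p' : ℕ) + q, by simp⟩ : Fin (p' + 1 + q)) = l :=
        Fin.ext (by simp [hldef])
      rw [this, hσ.2.2.2 l (by simp; omega)]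

variable (K V) in
/-- The product `(P, Q) ↦ P ∘ Q`, `C^p(V, V) × C^q(V, V) → C^{p+q}(V, V)`. -/
def comp (p q : ℕ) : Cochain K V V p →ₗ[K] Cochain K V V q →ₗ[K] Cochain K V V (p + q) :=
  LinearMap.mk₂ K (fun P Q => ⟨compAux P.1 Q.1, compAux_mem P Q⟩)
    (fun P P' Q => by
      refine Subtype.ext (MultilinearMap.ext fun X => ?_)
      simp only [compAux_apply, Submodule.coe_add, add_apply, add_mul, smul_add,
        Finset.sum_add_distrib]
      abel)
    (fun c P Q => by
      refine Subtype.ext (MultilinearMap.ext fun X => ?_)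
      simp only [compAux_apply, Submodule.coe_smul, smul_apply, smul_mul_assoc,
        smul_comm _ c, ← Finset.smul_sum, ← smul_add])
    (fun P Q Q' => by
      refine Subtype.ext (MultilinearMap.ext fun X => ?_)
      simp only [compAux_apply, insertArgs_eq_update (Q.1 + Q'.1), insertArgs_eq_update Q.1,
        insertArgs_eq_update Q'.1, Submodule.coe_add,
        add_apply, mul_add, smul_add, map_add, LinearMap.add_apply,
        MultilinearMap.map_update_add, Finset.sum_add_distrib]
      abel)
    (fun c P Q => by
      refine Subtype.ext (MultilinearMap.ext fun X => ?_)
      simp only [compAux_apply, insertArgs_eq_update (c • Q.1), insertArgs_eq_update Q.1,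
        Submodule.coe_smul, smul_apply, mul_smul_comm, map_smul,
        LinearMap.smul_apply, MultilinearMap.map_update_smul,
        smul_comm _ c, ← Finset.smul_sum, ← smul_add])

variable (K V) in
/-- The graded commutator `[P, Q] = P ∘ Q - (-1)^{pq} Q ∘ P` on `C^*(V, V)`. -/
def lieBracket : Cochains K V V →ₗ[K] Cochains K V V →ₗ[K] Cochains K V V :=
  DirectSum.toModule K ℕ _ fun p => LinearMap.flip <| DirectSum.toModule K ℕ _ fun q =>
    LinearMap.flip <|
      (comp K V p q).compr₂ (DirectSum.lof K ℕ (fun n => Cochain K V V n) (p + q)) -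
        (-1 : K) ^ (p * q) • ((comp K V q p).compr₂
          (DirectSum.lof K ℕ (fun n => Cochain K V V n) (q + p))).flip

end Bracket

/-! ### The bracket `π + ρ + λμ`, the subspace `C^*(h, g)` and higher derived brackets -/

section Derived

variable {K g h : Type*} [Field K] [AddCommGroup g] [Module K g] [AddCommGroup h] [Module K h]

/-- The skew-symmetric map `π + ρ + λμ` on `g ⊕ h`:
`(x + u, y + v, z + w) ↦ [x, y, z] + ρ(x, y) w + ρ(y, z) u + ρ(z, x) v + λ [u, v, w]`. -/
def semidirect (π : ThreeLieAlgebra K g) (μ : ThreeLieAlgebra K h)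
    (ρ : g [⋀^Fin 2]→ₗ[K] Module.End K h) (lam : K) : (g × h) [⋀^Fin 3]→ₗ[K] (g × h) where
  toFun a :=
    (π.bracket ![(a 0).1, (a 1).1, (a 2).1],
      ρ ![(a 0).1, (a 1).1] (a 2).2 + ρ ![(a 1).1, (a 2).1] (a 0).2 +
        ρ ![(a 2).1, (a 0).1] (a 1).2 + lam • μ.bracket ![(a 0).2, (a 1).2, (a 2).2])
  map_update_add' {inst} m i x y := by
    obtain rfl : inst = instDecidableEqFin 3 := Subsingleton.elim _ _
    fin_cases i <;> ext <;>
      simp [map_add3_left, map_add3_mid, map_add3_right, map_add2_left, map_add2_right] <;> abel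
  map_update_smul' {inst} m i c x := by
    obtain rfl : inst = instDecidableEqFin 3 := Subsingleton.elim _ _
    fin_cases i <;> ext <;>
      simp [map_smul3_left, map_smul3_mid, map_smul3_right, map_smul2_left, map_smul2_right,
        smul_comm c lam]
  map_eq_zero_of_eq' v i j hv hij := by
    have h : v 0 = v 1 ∨ v 1 = v 2 ∨ v 0 = v 2 := by
      fin_cases i <;> fin_cases j <;> simp_all
    have e1 := map_eq_zero3 π.bracket (v 0).1 (v 1).1 (v 2).1 (by
      rcases h with h | h | h <;> simp [h])
    have e2 := map_eq_zero3 μ.bracket (v 0).2 (v 1).2 (v 2).2 (by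
      rcases h with h | h | h <;> simp [h])
    rw [e1, e2, smul_zero, add_zero, Prod.mk_eq_zero]
    refine ⟨rfl, ?_⟩
    rcases h with h | h | h
    · rw [h, map_self2, map_swap2 ρ (v 2).1]
      simp
    · rw [h, map_self2, map_swap2 ρ (v 2).1]
      simp
    · rw [h, map_self2, map_swap2 ρ (v 1).1]
      simp

/-- Transport of cochains along `a : V' → V` and `b : W → W'`:
`f ↦ b ∘ f(∧² a, …, ∧² a, a)`. -/
def Cochain.transport {V V' W W' : Type*} [AddCommGroup V] [Module K V] [AddCommGroup V']
    [Module K V'] [AddCommGroup W] [Module K W] [AddCommGroup W'] [Module K W']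
    (a : V' →ₗ[K] V) (b : W →ₗ[K] W') (n : ℕ) : Cochain K V W n →ₗ[K] Cochain K V' W' n where
  toFun f := ⟨(LinearMap.lcomp K W' a ∘ₗ LinearMap.llcomp K V W W' b).compMultilinearMap
      (f.1.compLinearMap fun _ => exteriorPower.map 2 a), fun X i hi x y hX => by
        simp only [LinearMap.compMultilinearMap_apply, MultilinearMap.compLinearMap_apply,
          LinearMap.comp_apply, LinearMap.llcomp_apply, LinearMap.lcomp_apply]
        rw [f.2 _ i hi (a x) (a y) (by
          simp only [hX, exteriorPower.map_apply_ιMulti]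
          congr 1
          funext j
          fin_cases j <;> rfl), map_zero]⟩
  map_add' f f' := Subtype.ext <| MultilinearMap.ext fun X => LinearMap.ext fun x => by simp
  map_smul' c f := Subtype.ext <| MultilinearMap.ext fun X => LinearMap.ext fun x => by simp

variable (K g h) in
/-- The inclusion of `F = C^*(h, g)` into `L = C^*(g ⊕ h, g ⊕ h)`. -/
def incl : Cochains K h g →ₗ[K] Cochains K (g × h) (g × h) :=
  DirectSum.lmap (Cochain.transport (LinearMap.snd K g h) (LinearMap.inl K g h))

variable (K g h) in
/-- The projection of `L = C^*(g ⊕ h, g ⊕ h)` onto `F = C^*(h, g)`: restrict the arguments to `h`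
and take the `g`-component of the value. -/
def proj : Cochains K (g × h) (g × h) →ₗ[K] Cochains K h g :=
  DirectSum.lmap (Cochain.transport (LinearMap.inr K g h) (LinearMap.fst K g h))

/-- The iterated bracket `[⋯[[Δ, a₁], a₂], ⋯, aₖ]` in `L`, for `aᵢ ∈ F`. -/
def iteratedBracket (Δ : Cochains K (g × h) (g × h)) :
    (k : ℕ) → MultilinearMap K (fun _ : Fin k => Cochains K h g) (Cochains K (g × h) (g × h))
  | 0 => MultilinearMap.constOfIsEmpty K _ Δ
  | k + 1 => MultilinearMap.uncurryRight
      (((lieBracket K (g × h)).compl₂ (incl K g h)).compMultilinearMap (iteratedBracket Δ k))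

/-- The higher derived brackets `lₖ(a₁, …, aₖ) = 𝒫 [⋯[[Δ, a₁], a₂], ⋯, aₖ]` on `C^*(h, g)` for
`Δ = π + ρ + λμ`. -/
def derivedBracket (π : ThreeLieAlgebra K g) (μ : ThreeLieAlgebra K h)
    (ρ : g [⋀^Fin 2]→ₗ[K] Module.End K h) (lam : K) (k : ℕ) (a : Fin k → Cochains K h g) :
    Cochains K h g :=
  proj K g h (iteratedBracket
    (DirectSum.lof K ℕ (fun n => Cochain K (g × h) (g × h) n) 1
      (ofAlternating (semidirect π μ ρ lam))) k a)

end Derived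

/-! ### Maurer-Cartan elements and twisting -/

section MaurerCartan

variable {K : Type*} [Field K] {C : ℕ → Type*} [∀ n, AddCommGroup (C n)] [∀ n, Module K (C n)]

variable (K) in
/-- The operations `l^α_k(x₁, …, xₖ) = ∑_{n ≥ 0} (1 / n!) l_{n+k}(α, …, α, x₁, …, xₖ)`
(a sum with finitely many nonzero terms). -/
def twist (l : (k : ℕ) → (Fin k → ⨁ n, C n) → ⨁ n, C n) (α : ⨁ n, C n) (k : ℕ)
    (x : Fin k → ⨁ n, C n) : ⨁ n, C n :=
  ∑ᶠ n : ℕ, (n.factorial : K)⁻¹ • l (n + k) (Fin.append (fun _ : Fin n => α) x)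

variable (K) in
/-- `α` is a Maurer-Cartan element: it has degree `0`, and the series
`∑_{n ≥ 1} (1 / n!) l_n(α, …, α)` has finitely many nonzero terms and sum `0`. -/
def IsMaurerCartan (l : (k : ℕ) → (Fin k → ⨁ n, C n) → ⨁ n, C n) (α : ⨁ n, C n) : Prop :=
  α ∈ LinearMap.range (DirectSum.lof K ℕ C 0) ∧
    ∃ N : ℕ, (∀ n > N, l n (fun _ => α) = 0) ∧
      ∑ n ∈ Finset.Icc 1 N, (n.factorial : K)⁻¹ • l n (fun _ => α) = 0

end MaurerCartan

/-- The operations `l^T_k` on `C^*(h, g)`: the twist by `T ∈ C^0(h, g) = Hom(h, g)` of the higher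
derived brackets. -/
def twistedBracket {K g h : Type*} [Field K] [AddCommGroup g] [Module K g] [AddCommGroup h]
    [Module K h] (π : ThreeLieAlgebra K g) (μ : ThreeLieAlgebra K h)
    (ρ : g [⋀^Fin 2]→ₗ[K] Module.End K h) (lam : K) (T : h →ₗ[K] g) (k : ℕ)
    (a : Fin k → Cochains K h g) : Cochains K h g :=
  twist K (derivedBracket π μ ρ lam) (ofHom T) k a

end ThreeLie

end

/-!
The Maurer-Cartan equation of a degree-zero element only involves brackets `[⋯[Δ, S₁], ⋯, Sₖ]`
of `Δ = π + ρ + λμ ∈ C^1(g ⊕ h, g ⊕ h)` with linear maps `Sᵢ : h → g`, extended by zero to `g ⊕ h`.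
All of these lie in `C^1`, and bracketing with `S ∈ gl(V)` is the infinitesimal action of `-S` on
trilinear maps (`bracketHom_eval₃`):
`[f, S](x, y, z) = f(S x, y, z) + f(x, S y, z) + f(x, y, S z) - S f(x, y, z)`.

As an extended map vanishes on `g` and takes values in `g`, three brackets produce a map that
factors through `h × h × h` and has values in `g` (`bracketHoms_three_eval₃`), and a fourth bracket
kills it (`bracketHoms_eq_zero`). So only `l₁`, `l₂`, `l₃` can be nonzero on `C^0(h, g)`. Explicitly,
`l₁(T)` is `-T ∘ λμ`, `l₂` vanishes, and `l₃` is the full polarization of the cubic part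
`[T u, T v, T w] - T (ρ(T u, T v) w + ρ(T v, T w) u + ρ(T w, T u) v)` of the Rota-Baxter identity.

Hence `∑ₖ lₖ(T, …, T) / k!` is the defect of `T` from being a relative Rota-Baxter operator. The sum
of the twisted brackets of `T'` is, by the Taylor expansion of this cubic polynomial at `T`, the
defect of `T + T'` minus the defect of `T` (`twistedHoms_sum_eval₃`). The latter is zero by
hypothesis, so the Maurer-Cartan equation of `T'` says that the defect of `T + T'` vanishes.
-/

noncomputable section

namespace ThreeLie

/-! ### Values of cochains of degree one -/

section Evaluation

variable {K V W : Type*} [Field K] [AddCommGroup V] [Module K V] [AddCommGroup W] [Module K W]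

/-- A linear map `V → W` as an element of `C^0(V, W)`; `ofHom` is its image in `C^*(V, W)`. -/
def cochainOfHom (S : V →ₗ[K] W) : Cochain K V W 0 :=
  ⟨MultilinearMap.constOfIsEmpty K _ S, fun _ i => i.elim0⟩

theorem lof_cochainOfHom (S : V →ₗ[K] W) :
    DirectSum.lof K ℕ (fun n => Cochain K V W n) 0 (cochainOfHom S) = ofHom S :=
  rfl

/-- The value `f (x ∧ y, z)` of a cochain `f ∈ C^1(V, W)`. It is unchanged by
cyclic permutations of `x, y, z`. For `f = ofAlternating φ` it is `φ (z, x, y)`. -/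
def eval₃ (f : Cochain K V W 1) (x y z : V) : W :=
  f.1 (fun _ => wedge K x y) z

/-- A cochain of degree one is determined by its values on decomposable elements of `∧² V`. -/
theorem cochain_ext₃ {f f' : Cochain K V W 1}
    (H : ∀ x y z, eval₃ f x y z = eval₃ f' x y z) : f = f' := by
  have key : f.1.toLinearMap 0 0 = f'.1.toLinearMap 0 0 := by
    apply exteriorPower.linearMap_ext
    ext v z
    have := H (v 0) (v 1) z
    have hv : ![v 0, v 1] = v := by funext i; fin_cases i <;> rfl
    have hu : ∀ Y : ⋀[K]^2 V, Function.update (0 : Fin 1 → ⋀[K]^2 V) 0 Y = fun _ => Y :=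
      fun Y => by funext i; obtain rfl := Subsingleton.elim i 0; simp
    simpa only [eval₃, wedge, hv, LinearMap.compAlternatingMap_apply,
      MultilinearMap.toLinearMap_apply, hu] using this
  refine Subtype.ext (MultilinearMap.ext fun X => ?_)
  have := LinearMap.congr_fun key (X 0)
  have hu : Function.update (0 : Fin 1 → ⋀[K]^2 V) 0 (X 0) = X := by
    funext i; obtain rfl := Subsingleton.elim i 0; simp
  simpa only [MultilinearMap.toLinearMap_apply, hu] using this

section EvalLinear

variable (f f' : Cochain K V W 1) (x y z : V)

@[simp] theorem zero_eval₃ : eval₃ (0 : Cochain K V W 1) x y z = 0 :=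
  rfl

@[simp] theorem add_eval₃ : eval₃ (f + f') x y z = eval₃ f x y z + eval₃ f' x y z :=
  rfl

@[simp] theorem smul_eval₃ (c : K) : eval₃ (c • f) x y z = c • eval₃ f x y z :=
  rfl

end EvalLinear

theorem ofAlternating_eval₃ (φ : V [⋀^Fin 3]→ₗ[K] W) (x y z : V) :
    eval₃ (ofAlternating φ) x y z = φ ![z, x, y] := by
  simp [eval₃, ofAlternating, exteriorPower.alternatingMapLinearEquiv_apply_ιMulti]

theorem transport_eval₃ {V' W' : Type*} [AddCommGroup V'] [Module K V'] [AddCommGroup W']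
    [Module K W'] (a : V' →ₗ[K] V) (b : W →ₗ[K] W') (f : Cochain K V W 1) (x y z : V') :
    eval₃ (Cochain.transport a b 1 f) x y z = b (eval₃ f (a x) (a y) (a z)) := by
  have : exteriorPower.map 2 a (wedge K x y) = wedge K (a x) (a y) := by
    simp only [exteriorPower.map_apply_ιMulti]
    congr 1
    funext j
    fin_cases j <;> rfl
  simp [eval₃, Cochain.transport, this]

end Evaluation

/-! ### The bracket with a linear endomorphism -/

section BracketHom

variable {K V : Type*} [Field K] [AddCommGroup V] [Module K V]

/-- The bracket `[f, S]` of `f ∈ C^1(V, V)` with `S ∈ C^0(V, V) = gl(V)`, as an element of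
`C^1(V, V)`. -/
def bracketHom (S : Module.End K V) (f : Cochain K V V 1) : Cochain K V V 1 :=
  comp K V 1 0 f (cochainOfHom S) - comp K V 0 1 (cochainOfHom S) f

theorem lieBracket_lof_one_ofHom (f : Cochain K V V 1) (S : Module.End K V) :
    lieBracket K V (DirectSum.lof K ℕ (fun n => Cochain K V V n) 1 f) (ofHom S) =
      DirectSum.lof K ℕ (fun n => Cochain K V V n) 1 (bracketHom S f) := by
  rw [← lof_cochainOfHom, bracketHom, map_sub, lieBracket, DirectSum.toModule_lof,
    LinearMap.flip_apply, DirectSum.toModule_lof]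
  simp

/-- Bracketing with `S` is the infinitesimal action of `-S` on trilinear maps. Each sum over shuffles
in `comp` has a single term, as a permutation of one letter is trivial. -/
theorem bracketHom_eval₃ (S : Module.End K V) (f : Cochain K V V 1) (x y z : V) :
    eval₃ (bracketHom S f) x y z =
      eval₃ f (S x) y z + eval₃ f x (S y) z + eval₃ f x y (S z) - S (eval₃ f x y z) := by
  have h₁ : shuffles (1 + 0) 0 0 = {1} := by decide
  have h₂ : shuffles (0 + 1) 0 1 = {1} := by decide
  have h₃ : shuffles (1 + 0) 1 0 = {1} := by decide
  have e₁ : (comp K V 1 0 f (cochainOfHom S)).1 (fun _ => wedge K x y) z =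
      eval₃ f (S x) y z + eval₃ f x (S y) z + eval₃ f x y (S z) := by
    have hi : insertArgs (cochainOfHom S).1 (0 : Fin 1) (fun _ => wedge K x y) =
        Function.update (0 : Fin 1 → ⋀[K]^2 V) 0 (wedge K (S x) y + wedge K x (S y)) := by
      funext j
      obtain rfl := Subsingleton.elim j 0
      simp [insertArgs, cochainOfHom, der_wedge]
    have hu : ∀ Y : ⋀[K]^2 V, Function.update (0 : Fin 1 → ⋀[K]^2 V) 0 Y = fun _ => Y :=
      fun Y => by funext i; obtain rfl := Subsingleton.elim i 0; simp
    simp only [comp, LinearMap.mk₂_apply, compAux_apply, Finset.univ_unique, Finset.sum_singleton,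
      Fin.default_eq_zero, Fin.val_zero, Fin.isValue, h₁, h₃, hi,
      MultilinearMap.map_update_add]
    simp [hu, eval₃, cochainOfHom]
  have e₂ : (comp K V 0 1 (cochainOfHom S) f).1 (fun _ => wedge K x y) z =
      S (eval₃ f x y z) := by
    simp only [comp, LinearMap.mk₂_apply, compAux_apply, h₂]
    simp [eval₃, cochainOfHom]
  rw [← e₁, ← e₂]
  rfl

@[simp] theorem bracketHom_zero (S : Module.End K V) : bracketHom S 0 = 0 := by
  simp [bracketHom]

end BracketHom

/-! ### Iterated brackets with linear maps from `h` to `g` -/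

section DegreeZero

variable {K g h : Type*} [Field K] [AddCommGroup g] [Module K g] [AddCommGroup h] [Module K h]

/-- The extension by zero of `T : h → g` to an endomorphism of `g ⊕ h`. -/
def extendHom (T : h →ₗ[K] g) : Module.End K (g × h) :=
  LinearMap.inl K g h ∘ₗ T ∘ₗ LinearMap.snd K g h

@[simp] theorem extendHom_apply (T : h →ₗ[K] g) (a : g × h) : extendHom T a = (T a.2, 0) :=
  rfl

theorem incl_ofHom (T : h →ₗ[K] g) : incl K g h (ofHom T) = ofHom (extendHom T) := by
  rw [← lof_cochainOfHom, ← lof_cochainOfHom, incl, DirectSum.lmap_lof]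
  rfl

/-- The iterated bracket `[⋯[f, T₁], ⋯, Tₖ]` of `f ∈ C^1(g ⊕ h, g ⊕ h)` with linear maps
`Tᵢ : h → g`. -/
def bracketHoms (f : Cochain K (g × h) (g × h) 1) :
    (k : ℕ) → (Fin k → h →ₗ[K] g) → Cochain K (g × h) (g × h) 1
  | 0, _ => f
  | k + 1, T => bracketHom (extendHom (T (Fin.last k))) (bracketHoms f k (Fin.init T))

theorem iteratedBracket_succ (Δ : Cochains K (g × h) (g × h)) (k : ℕ)
    (a : Fin (k + 1) → Cochains K h g) :
    iteratedBracket Δ (k + 1) a =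
      lieBracket K (g × h) (iteratedBracket Δ k (Fin.init a)) (incl K g h (a (Fin.last k))) := by
  simp only [iteratedBracket, MultilinearMap.uncurryRight_apply,
    LinearMap.compMultilinearMap_apply, LinearMap.compl₂_apply]

theorem iteratedBracket_ofHom (f : Cochain K (g × h) (g × h) 1) (k : ℕ)
    (T : Fin k → h →ₗ[K] g) :
    iteratedBracket (DirectSum.lof K ℕ (fun n => Cochain K (g × h) (g × h) n) 1 f) k
      (fun i => ofHom (T i)) =
      DirectSum.lof K ℕ (fun n => Cochain K (g × h) (g × h) n) 1 (bracketHoms f k T) := by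
  induction k with
  | zero => rw [iteratedBracket, bracketHoms]; rfl
  | succ k ih =>
    have hT : Fin.init (fun i => ofHom (T i)) = fun i => ofHom (Fin.init T i) := rfl
    rw [iteratedBracket_succ, hT, ih, incl_ofHom, lieBracket_lof_one_ofHom, bracketHoms]

variable (π : ThreeLieAlgebra K g) (μ : ThreeLieAlgebra K h)
  (ρ : g [⋀^Fin 2]→ₗ[K] Module.End K h) (lam : K)

/-- The higher derived bracket `lₖ(T₁, …, Tₖ)` of linear maps `Tᵢ : h → g`, as an element
of `C^1(h, g)`. -/
def derivedHoms (k : ℕ) (T : Fin k → h →ₗ[K] g) : Cochain K h g 1 :=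
  Cochain.transport (LinearMap.inr K g h) (LinearMap.fst K g h) 1
    (bracketHoms (ofAlternating (semidirect π μ ρ lam)) k T)

theorem derivedBracket_ofHom (k : ℕ) (T : Fin k → h →ₗ[K] g) :
    derivedBracket π μ ρ lam k (fun i => ofHom (T i)) =
      DirectSum.lof K ℕ (fun n => Cochain K h g n) 1 (derivedHoms π μ ρ lam k T) := by
  rw [derivedBracket, iteratedBracket_ofHom, proj, DirectSum.lmap_lof]
  rfl

theorem semidirect_apply (x y z : g × h) : semidirect π μ ρ lam ![x, y, z] =
    (π.bracket ![x.1, y.1, z.1], ρ ![x.1, y.1] z.2 + ρ ![y.1, z.1] x.2 + ρ ![z.1, x.1] y.2 +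
      lam • μ.bracket ![x.2, y.2, z.2]) :=
  rfl

@[simp] theorem bracket_zero_left (y z : g) : π.bracket ![0, y, z] = 0 := by
  simpa using map_smul3_left π.bracket (0 : K) y z 0

@[simp] theorem bracket_zero_mid (x z : g) : π.bracket ![x, 0, z] = 0 := by
  simpa using map_smul3_mid π.bracket (0 : K) x z 0

@[simp] theorem bracket_zero_right (x y : g) : π.bracket ![x, y, 0] = 0 := by
  simpa using map_smul3_right π.bracket (0 : K) x y 0

@[simp] theorem action_zero_left (y : g) : ρ ![0, y] = 0 := by
  simpa using map_smul2_left ρ (0 : K) y 0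

@[simp] theorem action_zero_right (x : g) : ρ ![x, 0] = 0 := by
  simpa using map_smul2_right ρ (0 : K) x 0

/-! ### Derived brackets and the Rota-Baxter identity -/

/-- The trilinear expression in `A, B, C : h → g` whose restriction to the diagonal is the part
`[T u, T v, T w] - T (ρ(T u, T v) w + ρ(T v, T w) u + ρ(T w, T u) v)` of the relative Rota-Baxter
identity that does not involve the weight. -/
def rotaBaxterForm (A B C : h →ₗ[K] g) (u v w : h) : g :=
  π.bracket ![A u, B v, C w] - C (ρ ![A u, B v] w) - A (ρ ![B v, C w] u) - B (ρ ![C w, A u] v)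

theorem isRelativeRotaBaxter_iff (T : h →ₗ[K] g) :
    IsRelativeRotaBaxter π μ ρ lam T ↔ ∀ u v w,
      rotaBaxterForm π ρ T T T u v w - T (lam • μ.bracket ![u, v, w]) = 0 := by
  refine forall_congr' fun u => forall_congr' fun v => forall_congr' fun w => ?_
  rw [← sub_eq_zero, rotaBaxterForm, map_add, map_add, map_add]
  abel_nf

/-- The full symmetrization of `rotaBaxterForm` in the three linear maps. -/
def symmRotaBaxterForm (A B C : h →ₗ[K] g) (u v w : h) : g :=
  rotaBaxterForm π ρ A B C u v w + rotaBaxterForm π ρ A C B u v w +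
    rotaBaxterForm π ρ B A C u v w + rotaBaxterForm π ρ B C A u v w +
    rotaBaxterForm π ρ C A B u v w + rotaBaxterForm π ρ C B A u v w

/-- The threefold bracket depends only on the `h`-components of the arguments and takes values
in `g`. -/
theorem bracketHoms_three_eval₃ (T : Fin 3 → h →ₗ[K] g) (x y z : g × h) :
    eval₃ (bracketHoms (ofAlternating (semidirect π μ ρ lam)) 3 T) y z x =
      (symmRotaBaxterForm π ρ (T 0) (T 1) (T 2) x.2 y.2 z.2, 0) := by
  have e₀ : Fin.init (Fin.init T) 0 = T 0 := rfl
  have e₁ : Fin.init T 1 = T 1 := rfl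
  ext
  · simp [bracketHoms, bracketHom_eval₃, ofAlternating_eval₃, semidirect_apply, e₀, e₁,
      symmRotaBaxterForm, rotaBaxterForm]
    abel
  · simp [bracketHoms, bracketHom_eval₃, ofAlternating_eval₃, semidirect_apply]

theorem bracketHoms_eq_zero (k : ℕ) (hk : 4 ≤ k) (T : Fin k → h →ₗ[K] g) :
    bracketHoms (ofAlternating (semidirect π μ ρ lam)) k T = 0 := by
  induction k, hk using Nat.le_induction with
  | base =>
    refine cochain_ext₃ fun x y z => ?_
    -- the first three terms have an argument in `g`, the last one applies `T` to a value in `g`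
    rw [bracketHoms, bracketHom_eval₃]
    simp [bracketHoms_three_eval₃, symmRotaBaxterForm, rotaBaxterForm]
  | succ k _ ih => rw [bracketHoms, ih, bracketHom_zero]

theorem derivedHoms_eq_zero (k : ℕ) (hk : 4 ≤ k) (T : Fin k → h →ₗ[K] g) :
    derivedHoms π μ ρ lam k T = 0 := by
  rw [derivedHoms, bracketHoms_eq_zero π μ ρ lam k hk, map_zero]

theorem derivedHoms_one_eval₃ (T : Fin 1 → h →ₗ[K] g) (u v w : h) :
    eval₃ (derivedHoms π μ ρ lam 1 T) v w u = -T 0 (lam • μ.bracket ![u, v, w]) := by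
  simp [derivedHoms, transport_eval₃, bracketHoms, bracketHom_eval₃, ofAlternating_eval₃,
    semidirect_apply]

theorem derivedHoms_two (T : Fin 2 → h →ₗ[K] g) : derivedHoms π μ ρ lam 2 T = 0 := by
  refine cochain_ext₃ fun u v w => ?_
  simp [derivedHoms, transport_eval₃, bracketHoms, bracketHom_eval₃, ofAlternating_eval₃,
    semidirect_apply]

theorem derivedHoms_three_eval₃ (T : Fin 3 → h →ₗ[K] g) (u v w : h) :
    eval₃ (derivedHoms π μ ρ lam 3 T) v w u =
      symmRotaBaxterForm π ρ (T 0) (T 1) (T 2) u v w := by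
  rw [derivedHoms, transport_eval₃, bracketHoms_three_eval₃]
  rfl

/-! ### Twisting and the Maurer-Cartan equation -/

/-- The twisted bracket `l^T_k(T', …, T')` of a linear map `T' : h → g`, as an element
of `C^1(h, g)`. The sum stops at `n = 3`, as `l_{n+k}` vanishes on linear maps when `n + k ≥ 4`. -/
def twistedHoms (T T' : h →ₗ[K] g) (k : ℕ) : Cochain K h g 1 :=
  ∑ n ∈ Finset.range 4, (n.factorial : K)⁻¹ •
    derivedHoms π μ ρ lam (n + k) (Fin.append (fun _ => T) fun _ => T')

theorem twistedBracket_ofHom (T T' : h →ₗ[K] g) (k : ℕ) :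
    twistedBracket π μ ρ lam T k (fun _ => ofHom T') =
      DirectSum.lof K ℕ (fun n => Cochain K h g n) 1 (twistedHoms π μ ρ lam T T' k) := by
  have key : ∀ n, derivedBracket π μ ρ lam (n + k)
      (Fin.append (fun _ : Fin n => ofHom T) fun _ : Fin k => ofHom T') =
      DirectSum.lof K ℕ (fun n => Cochain K h g n) 1
        (derivedHoms π μ ρ lam (n + k) (Fin.append (fun _ => T) fun _ => T')) := by
    intro n
    rw [← derivedBracket_ofHom]
    congr 1
    funext i
    induction i using Fin.addCases <;> simp
  rw [twistedBracket, twist, twistedHoms, map_sum]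
  simp only [key, map_smul]
  refine finsum_eq_sum_of_support_subset _ fun n hn => ?_
  by_contra hn'
  simp only [Finset.coe_range, Set.mem_Iio, not_lt] at hn'
  exact hn (by simp [derivedHoms_eq_zero π μ ρ lam (n + k) (by omega)])

theorem twistedHoms_eq_zero (T T' : h →ₗ[K] g) (k : ℕ) (hk : 4 ≤ k) :
    twistedHoms π μ ρ lam T T' k = 0 :=
  Finset.sum_eq_zero fun n _ => by
    rw [derivedHoms_eq_zero π μ ρ lam (n + k) (by omega), smul_zero]

theorem twistedHoms_one_eval₃ (T T' : h →ₗ[K] g) (u v w : h) :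
    eval₃ (twistedHoms π μ ρ lam T T' 1) v w u =
      (2 : K)⁻¹ • symmRotaBaxterForm π ρ T T T' u v w - T' (lam • μ.bracket ![u, v, w]) := by
  have h₁ := derivedHoms_one_eval₃ π μ ρ lam
    (Fin.append (fun _ : Fin 0 => T) fun _ : Fin 1 => T') u v w
  have h₂ := derivedHoms_two π μ ρ lam (Fin.append (fun _ : Fin 1 => T) fun _ : Fin 1 => T')
  have h₃ := derivedHoms_three_eval₃ π μ ρ lam
    (Fin.append (fun _ : Fin 2 => T) fun _ : Fin 1 => T') u v w
  have h₄ := derivedHoms_eq_zero π μ ρ lam 4 le_rfl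
    (Fin.append (fun _ : Fin 3 => T) fun _ : Fin 1 => T')
  -- evaluate `Fin.append`
  change _ = -T' _ at h₁
  change _ = symmRotaBaxterForm π ρ T T T' u v w at h₃
  simp only [twistedHoms, Finset.sum_range_succ, Finset.range_zero, Finset.sum_empty, zero_add,
    Nat.reduceAdd, add_eval₃, smul_eval₃, h₁, h₂, h₃, h₄, zero_eval₃]
  simp [Nat.factorial]
  abel

theorem twistedHoms_two_eval₃ (T T' : h →ₗ[K] g) (u v w : h) :
    eval₃ (twistedHoms π μ ρ lam T T' 2) v w u = symmRotaBaxterForm π ρ T T' T' u v w := by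
  have h₂ := derivedHoms_two π μ ρ lam (Fin.append (fun _ : Fin 0 => T) fun _ : Fin 2 => T')
  have h₃ := derivedHoms_three_eval₃ π μ ρ lam
    (Fin.append (fun _ : Fin 1 => T) fun _ : Fin 2 => T') u v w
  have h₄ := derivedHoms_eq_zero π μ ρ lam 4 le_rfl
    (Fin.append (fun _ : Fin 2 => T) fun _ : Fin 2 => T')
  have h₅ := derivedHoms_eq_zero π μ ρ lam 5 (by omega)
    (Fin.append (fun _ : Fin 3 => T) fun _ : Fin 2 => T')
  -- evaluate `Fin.append`
  change _ = symmRotaBaxterForm π ρ T T' T' u v w at h₃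
  simp only [twistedHoms, Finset.sum_range_succ, Finset.range_zero, Finset.sum_empty, zero_add,
    Nat.reduceAdd, add_eval₃, smul_eval₃, h₂, h₃, h₄, h₅, zero_eval₃]
  simp

theorem twistedHoms_three_eval₃ (T T' : h →ₗ[K] g) (u v w : h) :
    eval₃ (twistedHoms π μ ρ lam T T' 3) v w u = symmRotaBaxterForm π ρ T' T' T' u v w := by
  have h₃ := derivedHoms_three_eval₃ π μ ρ lam
    (Fin.append (fun _ : Fin 0 => T) fun _ : Fin 3 => T') u v w
  have h₄ := derivedHoms_eq_zero π μ ρ lam 4 le_rfl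
    (Fin.append (fun _ : Fin 1 => T) fun _ : Fin 3 => T')
  have h₅ := derivedHoms_eq_zero π μ ρ lam 5 (by omega)
    (Fin.append (fun _ : Fin 2 => T) fun _ : Fin 3 => T')
  have h₆ := derivedHoms_eq_zero π μ ρ lam 6 (by omega)
    (Fin.append (fun _ : Fin 3 => T) fun _ : Fin 3 => T')
  -- evaluate `Fin.append`
  change _ = symmRotaBaxterForm π ρ T' T' T' u v w at h₃
  simp only [twistedHoms, Finset.sum_range_succ, Finset.range_zero, Finset.sum_empty, zero_add,
    Nat.reduceAdd, add_eval₃, smul_eval₃, h₃, h₄, h₅, h₆, zero_eval₃]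
  simp

/-- The Taylor expansion at `T` of the cubic map `T ↦ rotaBaxterForm π ρ T T T`. -/
theorem rotaBaxterForm_add_diag [CharZero K] (T T' : h →ₗ[K] g) (u v w : h) :
    rotaBaxterForm π ρ (T + T') (T + T') (T + T') u v w =
      rotaBaxterForm π ρ T T T u v w + (2 : K)⁻¹ • symmRotaBaxterForm π ρ T T T' u v w +
        (2 : K)⁻¹ • symmRotaBaxterForm π ρ T T' T' u v w +
        (6 : K)⁻¹ • symmRotaBaxterForm π ρ T' T' T' u v w := by
  simp only [symmRotaBaxterForm, rotaBaxterForm, LinearMap.add_apply, map_add3_left, map_add3_mid,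
    map_add3_right, map_add2_left, map_add2_right, map_add]
  module

/-- The Maurer-Cartan sum of `T'` evaluates to the Rota-Baxter defect of `T + T'` minus that
of `T`. -/
theorem twistedHoms_sum_eval₃ [CharZero K] (T T' : h →ₗ[K] g) (u v w : h) :
    eval₃ (twistedHoms π μ ρ lam T T' 1 + (1 / 2 : K) • twistedHoms π μ ρ lam T T' 2 +
        (1 / 6 : K) • twistedHoms π μ ρ lam T T' 3) v w u =
      (rotaBaxterForm π ρ (T + T') (T + T') (T + T') u v w -
          (T + T') (lam • μ.bracket ![u, v, w])) -
        (rotaBaxterForm π ρ T T T u v w - T (lam • μ.bracket ![u, v, w])) := by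
  rw [add_eval₃, add_eval₃, smul_eval₃, smul_eval₃, twistedHoms_one_eval₃, twistedHoms_two_eval₃,
    twistedHoms_three_eval₃, rotaBaxterForm_add_diag, one_div, one_div, LinearMap.add_apply]
  abel

theorem sum_Icc_eq_of_eventually_zero {M : Type*} [AddCommMonoid M] {f : ℕ → M} {N N' : ℕ}
    (hN : ∀ n > N, f n = 0) (hN' : ∀ n > N', f n = 0) :
    ∑ n ∈ Finset.Icc 1 N, f n = ∑ n ∈ Finset.Icc 1 N', f n := by
  have key : ∀ {a b : ℕ}, a ≤ b → (∀ n > a, f n = 0) →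
      ∑ n ∈ Finset.Icc 1 a, f n = ∑ n ∈ Finset.Icc 1 b, f n := fun hab ha =>
    Finset.sum_subset (Finset.Icc_subset_Icc_right hab) fun n hn hn' => ha n (by
      simp only [Finset.mem_Icc] at hn hn'
      omega)
  rcases le_total N N' with h | h
  · exact key h hN
  · exact (key h hN').symm

/-- If the brackets of order greater than `3` vanish at `a`, the Maurer-Cartan series is the sum of
its first three terms. -/
theorem isMaurerCartan_iff_of_eq_zero {C : ℕ → Type*} [∀ n, AddCommGroup (C n)]
    [∀ n, Module K (C n)] (l : (k : ℕ) → (Fin k → ⨁ n, C n) → ⨁ n, C n) (a : C 0)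
    (hl : ∀ k > 3, l k (fun _ => DirectSum.lof K ℕ C 0 a) = 0) :
    let t := DirectSum.lof K ℕ C 0 a
    IsMaurerCartan K l t ↔
      l 1 (fun _ => t) + (1 / 2 : K) • l 2 (fun _ => t) + (1 / 6 : K) • l 3 (fun _ => t) = 0 := by
  intro t
  have e : ∑ n ∈ Finset.Icc 1 3, (n.factorial : K)⁻¹ • l n (fun _ => t) =
      l 1 (fun _ => t) + (1 / 2 : K) • l 2 (fun _ => t) + (1 / 6 : K) • l 3 (fun _ => t) := by
    have : Finset.Icc 1 3 = {1, 2, 3} := by decide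
    simp [this, Nat.factorial, add_assoc]
  rw [← e]
  refine ⟨fun ⟨_, N, hN, hs⟩ => ?_, fun hs => ⟨⟨a, rfl⟩, 3, hl, hs⟩⟩
  rw [← hs]
  exact sum_Icc_eq_of_eventually_zero (fun n hn => by rw [hl n hn, smul_zero])
    fun n hn => by rw [hN n hn, smul_zero]

theorem twistedBracket_sum_eq_zero_iff [CharZero K] {T : h →ₗ[K] g}
    (hT : IsRelativeRotaBaxter π μ ρ lam T) (T' : h →ₗ[K] g) :
    twistedBracket π μ ρ lam T 1 (fun _ => ofHom T') +
        (1 / 2 : K) • twistedBracket π μ ρ lam T 2 (fun _ => ofHom T') +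
        (1 / 6 : K) • twistedBracket π μ ρ lam T 3 (fun _ => ofHom T') = 0 ↔
      IsRelativeRotaBaxter π μ ρ lam (T + T') := by
  rw [isRelativeRotaBaxter_iff] at hT ⊢
  simp only [twistedBracket_ofHom, ← map_smul, ← map_add]
  have hinj : Function.Injective (DirectSum.lof K ℕ (fun n => Cochain K h g n) 1) :=
    DirectSum.of_injective 1
  rw [map_eq_zero_iff _ hinj]
  constructor
  · intro H u v w
    have := twistedHoms_sum_eval₃ π μ ρ lam T T' u v w
    rwa [H, zero_eval₃, hT, sub_zero, eq_comm] at this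
  · intro H
    refine cochain_ext₃ fun v w u => ?_
    rw [twistedHoms_sum_eval₃, H, hT, sub_zero, zero_eval₃]

end DegreeZero

end ThreeLie
end

theorem mainTheorem4 {K g h : Type*} [Field K] [CharZero K]
    [AddCommGroup g] [Module K g] [AddCommGroup h] [Module K h]
    (π : ThreeLie.ThreeLieAlgebra K g) (μ : ThreeLie.ThreeLieAlgebra K h)
    (ρ : g [⋀^Fin 2]→ₗ[K] Module.End K h) (hρ : ThreeLie.IsAction π μ ρ) (lam : K)
    (T : h →ₗ[K] g) (hT : ThreeLie.IsRelativeRotaBaxter π μ ρ lam T) (T' : h →ₗ[K] g) :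
    let lT := ThreeLie.twistedBracket π μ ρ lam T
    let t := ThreeLie.ofHom T'
    (ThreeLie.IsRelativeRotaBaxter π μ ρ lam (T + T') ↔ ThreeLie.IsMaurerCartan K lT t) ∧
      (ThreeLie.IsMaurerCartan K lT t ↔
        lT 1 ![t] + (1 / 2 : K) • lT 2 ![t, t] + (1 / 6 : K) • lT 3 ![t, t, t] = 0) := by
  intro lT t
  have e₁ : ![t] = fun _ => t := by funext i; fin_cases i; rfl
  have e₂ : ![t, t] = fun _ => t := by funext i; fin_cases i <;> rfl
  have e₃ : ![t, t, t] = fun _ => t := by funext i; fin_cases i <;> rfl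
  have hMC : ThreeLie.IsMaurerCartan K lT t ↔
      lT 1 (fun _ => t) + (1 / 2 : K) • lT 2 (fun _ => t) + (1 / 6 : K) • lT 3 (fun _ => t) = 0 :=
    ThreeLie.isMaurerCartan_iff_of_eq_zero lT (ThreeLie.cochainOfHom T') fun k hk =>
      (ThreeLie.twistedBracket_ofHom π μ ρ lam T T' k).trans (by
        rw [ThreeLie.twistedHoms_eq_zero π μ ρ lam T T' k hk, map_zero])
  rw [e₃, e₂, e₁, ← hMC]
  exact ⟨(ThreeLie.twistedBracket_sum_eq_zero_iff π μ ρ lam hT T').symm.trans hMC.symm, Iff.rfl⟩
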